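/- Let $K$ be a field, let $m,n\ge 0$, and let $R=K[x_0,\dots,x_m,y_0,\dots,y_n]$ be the polynomial ring, bigraded so that every $x_i$ has bidegree $(1,0)$ and every $y_j$ has bidegree $(0,1)$. Write $(x)=(x_0,\dots,x_m)$, $(y)=(y_0,\dots,y_n)$ and $(x,y)=(x_0,\dots,x_m,y_0,\dots,y_n)$. For a graded ring $A$ (graded by an abelian group), a homogeneous ideal $I\subseteq A$ and a graded $A$-module $M$, let $$H^i_I(M)_k=\varinjlim_{t}\operatorname{Ext}^i\bigl(A/I^t,\,M(k)\bigr)$$ denote the degree $k$ part of the graded local cohomology, where $\operatorname{Ext}$ is taken in the category of graded $A$-modules with degree-preserving maps, and $M(k)_j=M_{j+k}$. For a bigraded $R$-module $M$, let $M^{\sharp}$ be $M$ with the grading by total degree, $M^{\sharp}_s=\bigoplus_{a+b=s}M_{a,b}$, regarded as a $\mathbb Z$-graded module over $R^{\sharp}$. For $d\ge 0$ and $p,p'\in\mathbb Z$, say that $M$ satisfies $VC_d(p,p')$ if for all integers $i\ge 0$ and all $k,k'\in\mathbb Z$: * $H^i_{(x)}(M)_{k,k'}=0$ whenever $k\ge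 p+d+1-i$ (and $k'$ is arbitrary); * $H^i_{(y)}(M)_{k,k'}=0$ whenever $k'\ge p'+d+1-i$ (and $k$ is arbitrary); * $H^i_{(x,y)}(M^{\sharp})_{k+k'}=0$ whenever $k+k'\ge p+p'+d+1-i$. Call $M$ strongly $(p,p')$-regular if it satisfies $VC_0(p,p')$. Then $R$, as a bigraded module over itself, is strongly $(0,0)$-regular. -/

import Mathlib

open CategoryTheory CategoryTheory.Limits

universe u

/-! ### Direct sum decompositions and their projections -/

namespace GradedAux

/-- A family of additive subobjects that spans and admits a compatible family of projections is a
direct sum decomposition. -/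
theorem isInternal_of_proj {ι M σ : Type*} [DecidableEq ι] [AddCommGroup M] [SetLike σ M]
    [AddSubmonoidClass σ M] (ℳ : ι → σ)
    (hspan : ∀ x : M, x ∈ AddSubmonoid.closure (⋃ i, (ℳ i : Set M)))
    (π : ι → M →+ M) (h1 : ∀ i, ∀ x ∈ ℳ i, π i x = x)
    (h2 : ∀ i j, i ≠ j → ∀ x ∈ ℳ i, π j x = 0) : DirectSum.IsInternal ℳ := by
  have key : ∀ (j : ι) (d : DirectSum ι fun i => ℳ i),
      π j (DirectSum.coeAddMonoidHom ℳ d) = d j := by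
    intro j d
    induction d using DirectSum.induction_on with
    | zero => simp
    | of i x =>
      rw [DirectSum.coeAddMonoidHom_of]
      by_cases hij : i = j
      · subst hij
        rw [h1 i x x.2, DirectSum.of_eq_same]
      · rw [h2 i j hij x x.2, DirectSum.of_eq_of_ne _ _ _ (Ne.symm hij)]
        simp
    | add a b ha hb => simp [ha, hb]
  constructor
  · intro a b hab
    refine DFinsupp.ext fun j => Subtype.ext ?_
    have := congrArg (π j) hab
    rwa [key, key] at this
  · intro x
    have hx := hspan x
    induction hx using AddSubmonoid.closure_induction with
    | mem y hy =>
      obtain ⟨i, hi⟩ := Set.mem_iUnion.1 hy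
      exact ⟨DirectSum.of (fun i => ℳ i) i ⟨y, hi⟩, DirectSum.coeAddMonoidHom_of ℳ _ _⟩
    | zero => exact ⟨0, map_zero _⟩
    | add a b _ _ ha hb =>
      obtain ⟨a', rfl⟩ := ha
      obtain ⟨b', rfl⟩ := hb
      exact ⟨a' + b', map_add _ _ _⟩

section

variable {ι M σ : Type*} [DecidableEq ι] [AddCommGroup M] [SetLike σ M]
  [AddSubmonoidClass σ M] {ℳ : ι → σ} (h : DirectSum.IsInternal ℳ)

/-- The inverse of the sum map of a direct sum decomposition. -/
noncomputable def split : M ≃+ DirectSum ι fun i => ℳ i :=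
  (AddEquiv.ofBijective (DirectSum.coeAddMonoidHom ℳ) h).symm

/-- The projection onto the component of degree `i`. -/
noncomputable def proj (i : ι) : M →+ M where
  toFun x := (split h x i : M)
  map_zero' := by simp
  map_add' x y := by simp

theorem split_of_mem {i : ι} {x : M} (hx : x ∈ ℳ i) :
    split h x = DirectSum.of (fun i => ℳ i) i ⟨x, hx⟩ := by
  rw [split, AddEquiv.symm_apply_eq]
  exact (DirectSum.coeAddMonoidHom_of ℳ i ⟨x, hx⟩).symm

theorem proj_mem (i : ι) (x : M) : proj h i x ∈ ℳ i := (split h x i).2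

theorem proj_same {i : ι} {x : M} (hx : x ∈ ℳ i) : proj h i x = x := by
  change (split h x i : M) = x
  rw [split_of_mem h hx, DirectSum.of_eq_same]

theorem proj_ne {i j : ι} (hij : i ≠ j) {x : M} (hx : x ∈ ℳ i) : proj h j x = 0 := by
  change (split h x j : M) = 0
  rw [split_of_mem h hx, DirectSum.of_eq_of_ne _ _ _ (Ne.symm hij), ZeroMemClass.coe_zero]

/-- Every element is the sum of its homogeneous components. -/
theorem induction_proj {P : M → Prop} (x : M) (h0 : P 0) (hadd : ∀ a b, P a → P b → P (a + b))
    (hP : ∀ i, P (proj h i x)) : P x := by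
  classical
  have hx : x = ∑ i ∈ (split h x).support, proj h i x := by
    have e : DirectSum.coeAddMonoidHom ℳ (split h x) = x :=
      (AddEquiv.ofBijective (DirectSum.coeAddMonoidHom ℳ) h).apply_symm_apply x
    conv_lhs => rw [← e, ← DirectSum.sum_support_of (split h x)]
    rw [map_sum]
    exact Finset.sum_congr rfl fun i _ => DirectSum.coeAddMonoidHom_of ℳ i _
  rw [hx]
  exact Finset.sum_induction _ P hadd h0 fun i _ => hP i

theorem eq_of_mem_of_map {M' : Type*} [AddCommGroup M'] {σ' : Type*} [SetLike σ' M']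
    [AddSubmonoidClass σ' M'] {ℳ' : ι → σ'} (h' : DirectSum.IsInternal ℳ') (f : M →+ M')
    (hf : ∀ i, ∀ x ∈ ℳ i, f x ∈ ℳ' i) (i : ι) (x : M) : f (proj h i x) = proj h' i (f x) := by
  have hx : x ∈ (AddMonoidHom.eqLocusM (f.comp (proj h i)) ((proj h' i).comp f)) := by
    refine induction_proj h (P := fun x => x ∈ AddMonoidHom.eqLocusM _ _) x (zero_mem _)
      (fun a b => add_mem) fun j => ?_
    change f (proj h i (proj h j x)) = proj h' i (f (proj h j x))
    have hj := proj_mem h j x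
    by_cases hij : j = i
    · subst hij
      rw [proj_same h hj, proj_same h' (hf _ _ hj)]
    · rw [proj_ne h hij hj, proj_ne h' hij (hf _ _ hj), map_zero]
  exact hx

end

/-- A decomposition indexed by `ι`, collected along the fibres of a map `φ : ι → κ`, is a
decomposition indexed by `κ`. -/
theorem isInternal_fibres {ι κ M σ τ : Type*} [DecidableEq ι] [DecidableEq κ] [AddCommGroup M]
    [SetLike σ M] [AddSubmonoidClass σ M] [SetLike τ M] [AddSubmonoidClass τ M]
    {ℳ : ι → σ} (h : DirectSum.IsInternal ℳ) (φ : ι → κ) (𝒩 : κ → τ)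
    (h𝒩 : ∀ i, ∀ x ∈ ℳ i, x ∈ 𝒩 (φ i))
    (hmin : ∀ n (S : AddSubmonoid M), (∀ i, φ i = n → ∀ x ∈ ℳ i, x ∈ S) → ∀ x ∈ 𝒩 n, x ∈ S) :
    DirectSum.IsInternal 𝒩 := by
  let π : κ → M →+ M := fun n =>
    (DirectSum.coeAddMonoidHom ℳ).comp
      ((DFinsupp.filterAddMonoidHom (fun i => ℳ i) (fun i => φ i = n)).comp
        (split h).toAddMonoidHom)
  have hπ : ∀ (n : κ) (i : ι) (x : M), x ∈ ℳ i → π n x = if φ i = n then x else 0 := by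
    intro n i x hx
    change DirectSum.coeAddMonoidHom ℳ (DFinsupp.filter (fun i => φ i = n) (split h x)) = _
    rw [split_of_mem h hx]
    change DirectSum.coeAddMonoidHom ℳ
      (DFinsupp.filter (fun i => φ i = n) (DFinsupp.single i ⟨x, hx⟩)) = _
    rw [DFinsupp.filter_single]
    split_ifs
    · exact DirectSum.coeAddMonoidHom_of ℳ i ⟨x, hx⟩
    · exact map_zero _
  refine isInternal_of_proj 𝒩 ?_ π ?_ ?_
  · intro x
    refine induction_proj h (P := fun x => x ∈ AddSubmonoid.closure _) x (zero_mem _)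
      (fun a b => add_mem) fun i => ?_
    exact AddSubmonoid.subset_closure
      (Set.mem_iUnion.2 ⟨φ i, h𝒩 _ _ (proj_mem h i x)⟩)
  · intro n x hx
    exact hmin n (AddMonoidHom.eqLocusM (π n) (AddMonoidHom.id M))
      (fun i hi y hy => by
        change π n y = y
        rw [hπ n i y hy, if_pos hi]) x hx
  · intro n n' hne x hx
    exact hmin n (AddMonoidHom.eqLocusM (π n') 0)
      (fun i hi y hy => by
        change π n' y = 0
        rw [hπ n' i y hy, if_neg (by rw [hi]; exact hne)]) x hx

end GradedAux

open GradedAux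

/-! ### The abelian category of graded modules -/

/-- A graded module over a graded commutative ring `A = ⨁ 𝒜 i`: an `A`-module `M` with a direct sum
decomposition `M = ⨁ M i` such that `𝒜 i • M j ⊆ M (i + j)`. -/
structure GrMod {K : Type u} {A : Type u} {ι : Type} [CommRing K] [CommRing A] [Algebra K A]
    [DecidableEq ι] [AddCommGroup ι] (𝒜 : ι → Submodule K A) : Type (u + 1) where
  carrier : Type u
  [addCommGroup : AddCommGroup carrier]
  [module : Module A carrier]
  deg : ι → AddSubgroup carrier
  isInternal : DirectSum.IsInternal deg
  smul_mem : ∀ (i j : ι) (a : A) (x : carrier), a ∈ 𝒜 i → x ∈ deg j → a • x ∈ deg (i + j)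

namespace GrMod

variable {K : Type u} {A : Type u} {ι : Type} [CommRing K] [CommRing A] [Algebra K A]
  [DecidableEq ι] [AddCommGroup ι] {𝒜 : ι → Submodule K A}

instance : CoeSort (GrMod 𝒜) (Type u) := ⟨carrier⟩

instance (M : GrMod 𝒜) : AddCommGroup M := M.addCommGroup

instance (M : GrMod 𝒜) : Module A M := M.module

/-- Morphisms of graded modules: linear maps that preserve degrees. -/
@[ext]
structure Hom (M N : GrMod 𝒜) where
  lin : M →ₗ[A] N
  map_deg : ∀ i, ∀ x ∈ M.deg i, lin x ∈ N.deg i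

section HomGroup

variable {M N : GrMod 𝒜}

instance : Zero (Hom M N) := ⟨⟨0, fun _ _ _ => zero_mem _⟩⟩

instance : Add (Hom M N) :=
  ⟨fun f g => ⟨f.lin + g.lin, fun i x h => add_mem (f.map_deg i x h) (g.map_deg i x h)⟩⟩

instance : Neg (Hom M N) := ⟨fun f => ⟨-f.lin, fun i x h => neg_mem (f.map_deg i x h)⟩⟩

instance : Sub (Hom M N) :=
  ⟨fun f g => ⟨f.lin - g.lin, fun i x h => sub_mem (f.map_deg i x h) (g.map_deg i x h)⟩⟩

instance : SMul ℕ (Hom M N) :=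
  ⟨fun n f => ⟨n • f.lin, fun i x h => nsmul_mem (f.map_deg i x h) n⟩⟩

instance : SMul ℤ (Hom M N) :=
  ⟨fun n f => ⟨n • f.lin, fun i x h => zsmul_mem (f.map_deg i x h) n⟩⟩

theorem lin_injective : Function.Injective (Hom.lin : Hom M N → (M →ₗ[A] N)) :=
  fun _ _ h => Hom.ext h

instance : AddCommGroup (Hom M N) :=
  lin_injective.addCommGroup _ rfl (fun _ _ => rfl) (fun _ => rfl) (fun _ _ => rfl)
    (fun _ _ => rfl) (fun _ _ => rfl)

end HomGroup

instance : Category (GrMod 𝒜) where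
  Hom M N := Hom M N
  id M := ⟨LinearMap.id, fun _ _ h => h⟩
  comp f g := ⟨g.lin ∘ₗ f.lin, fun i x h => g.map_deg i _ (f.map_deg i x h)⟩

theorem hom_ext {M N : GrMod 𝒜} {f g : M ⟶ N} (h : ∀ x, f.lin x = g.lin x) : f = g :=
  Hom.ext (LinearMap.ext h)

@[simp] theorem id_lin (M : GrMod 𝒜) : Hom.lin (𝟙 M) = LinearMap.id := rfl

@[simp] theorem comp_lin {M N P : GrMod 𝒜} (f : M ⟶ N) (g : N ⟶ P) :
    (f ≫ g).lin = g.lin ∘ₗ f.lin := rfl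

instance : Preadditive (GrMod 𝒜) where
  homGroup M N := inferInstanceAs (AddCommGroup (Hom M N))
  add_comp _ _ _ f f' g := hom_ext fun x => map_add g.lin (f.lin x) (f'.lin x)
  comp_add _ _ _ _ _ _ := hom_ext fun _ => rfl

@[simp] theorem zero_lin {M N : GrMod 𝒜} : Hom.lin (0 : M ⟶ N) = 0 := rfl

@[simp] theorem add_lin {M N : GrMod 𝒜} (f g : M ⟶ N) :
    (f + g).lin = f.lin + g.lin := rfl

theorem map_proj {M N : GrMod 𝒜} (f : M ⟶ N) (i : ι) (x : M) :
    f.lin (proj M.isInternal i x) = proj N.isInternal i (f.lin x) :=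
  eq_of_mem_of_map M.isInternal N.isInternal f.lin.toAddMonoidHom f.map_deg i x

/-- A submodule is graded if it contains the homogeneous components of its elements. -/
def IsGradedSub (M : GrMod 𝒜) (N : Submodule A M) : Prop :=
  ∀ i, ∀ x ∈ N, proj M.isInternal i x ∈ N

/-- A graded submodule, with the induced grading. -/
def sub (M : GrMod 𝒜) (N : Submodule A M) (hN : M.IsGradedSub N) : GrMod 𝒜 where
  carrier := N
  deg i := (M.deg i).comap N.subtype.toAddMonoidHom
  isInternal := by
    let π : ι → N →+ N := fun i =>
      ((proj M.isInternal i).comp N.subtype.toAddMonoidHom).codRestrict N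
        (fun x => hN i x x.2)
    refine isInternal_of_proj _ ?_ π ?_ ?_
    · intro x
      have h : ∀ i, π i x ∈
          AddSubmonoid.closure (⋃ i, (((M.deg i).comap N.subtype.toAddMonoidHom) : Set N)) :=
        fun i => AddSubmonoid.subset_closure
          (Set.mem_iUnion.2 ⟨i, proj_mem M.isInternal i (x : M)⟩)
      have := induction_proj M.isInternal
        (P := fun y => y ∈ (AddSubmonoid.closure
          (⋃ i, (((M.deg i).comap N.subtype.toAddMonoidHom) : Set N))).map
            N.subtype.toAddMonoidHom) (x : M) (zero_mem _) (fun a b => add_mem)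
        (fun i => ⟨π i x, h i, rfl⟩)
      obtain ⟨y, hy, hyx⟩ := this
      rwa [← (Subtype.ext hyx : y = x)]
    · intro i x hx
      exact Subtype.ext (proj_same M.isInternal hx)
    · intro i j hij x hx
      exact Subtype.ext (proj_ne M.isInternal hij hx)
  smul_mem i j a x ha hx := M.smul_mem i j a x ha hx

/-- The quotient by a graded submodule, with the induced grading. -/
def quot (M : GrMod 𝒜) (N : Submodule A M) (hN : M.IsGradedSub N) : GrMod 𝒜 where
  carrier := M ⧸ N
  deg i := (M.deg i).map N.mkQ.toAddMonoidHom
  isInternal := by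
    let π : ι → (M ⧸ N) →+ (M ⧸ N) := fun i =>
      QuotientAddGroup.lift N.toAddSubgroup
        (N.mkQ.toAddMonoidHom.comp (proj M.isInternal i))
        (fun x hx => (Submodule.Quotient.mk_eq_zero N).2 (hN i x hx))
    have hπ : ∀ i (x : M), π i (N.mkQ x) = N.mkQ (proj M.isInternal i x) := fun i x => rfl
    refine isInternal_of_proj _ ?_ π ?_ ?_
    · intro x
      obtain ⟨x, rfl⟩ := N.mkQ_surjective x
      refine induction_proj M.isInternal (P := fun y => N.mkQ y ∈ AddSubmonoid.closure _) x
        (by rw [map_zero]; exact zero_mem _)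
        (fun a b ha hb => by rw [map_add]; exact add_mem ha hb) fun i => ?_
      exact AddSubmonoid.subset_closure
        (Set.mem_iUnion.2 ⟨i, _, proj_mem M.isInternal i x, rfl⟩)
    · rintro i _ ⟨x, hx, rfl⟩
      change π i (N.mkQ x) = N.mkQ x
      rw [hπ, proj_same M.isInternal hx]
    · rintro i j hij _ ⟨x, hx, rfl⟩
      change π j (N.mkQ x) = 0
      rw [hπ, proj_ne M.isInternal hij hx, map_zero]
  smul_mem := by
    rintro i j a _ ha ⟨x, hx, rfl⟩
    exact ⟨a • x, M.smul_mem i j a x ha hx, rfl⟩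

/-- The product of two graded modules. -/
def prod (M N : GrMod 𝒜) : GrMod 𝒜 where
  carrier := M × N
  deg i := (M.deg i).prod (N.deg i)
  isInternal := by
    refine isInternal_of_proj _ ?_
      (fun i => (proj M.isInternal i).prodMap (proj N.isInternal i)) ?_ ?_
    · rintro ⟨x, y⟩
      have hx : ((x, 0) : M × N) ∈
          AddSubmonoid.closure (⋃ i, (((M.deg i).prod (N.deg i)) : Set (M × N))) := by
        refine induction_proj M.isInternal (P := fun z => ((z, 0) : M × N) ∈ _) x (zero_mem _)
          (fun a b ha hb => by simpa using add_mem ha hb) fun i => ?_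
        exact AddSubmonoid.subset_closure
          (Set.mem_iUnion.2 ⟨i, proj_mem M.isInternal i x, zero_mem _⟩)
      have hy : ((0, y) : M × N) ∈
          AddSubmonoid.closure (⋃ i, (((M.deg i).prod (N.deg i)) : Set (M × N))) := by
        refine induction_proj N.isInternal (P := fun z => ((0, z) : M × N) ∈ _) y (zero_mem _)
          (fun a b ha hb => by simpa using add_mem ha hb) fun i => ?_
        exact AddSubmonoid.subset_closure
          (Set.mem_iUnion.2 ⟨i, zero_mem _, proj_mem N.isInternal i y⟩)
      simpa using add_mem hx hy
    · rintro i ⟨x, y⟩ ⟨hx, hy⟩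
      exact Prod.ext (proj_same M.isInternal hx) (proj_same N.isInternal hy)
    · rintro i j hij ⟨x, y⟩ ⟨hx, hy⟩
      exact Prod.ext (proj_ne M.isInternal hij hx) (proj_ne N.isInternal hij hy)
  smul_mem i j a x ha hx := ⟨M.smul_mem i j a x.1 ha hx.1, N.smul_mem i j a x.2 ha hx.2⟩

/-- The zero graded module. -/
def zero : GrMod 𝒜 where
  carrier := PUnit
  deg _ := ⊤
  isInternal := isInternal_of_proj _ (fun _ => zero_mem _) (fun _ => 0)
    (fun _ _ _ => rfl) (fun _ _ _ _ _ => rfl)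
  smul_mem _ _ _ _ _ _ := trivial

instance : HasZeroObject (GrMod 𝒜) :=
  ⟨zero, (IsZero.iff_id_eq_zero _).2 (hom_ext fun _ => rfl)⟩

instance : HasFiniteProducts (GrMod 𝒜) :=
  have : HasBinaryBiproducts (GrMod 𝒜) :=
    ⟨fun M N => hasBinaryBiproduct_of_total
      { pt := prod M N
        fst := ⟨LinearMap.fst A M N, fun _ _ h => h.1⟩
        snd := ⟨LinearMap.snd A M N, fun _ _ h => h.2⟩
        inl := ⟨LinearMap.inl A M N, fun _ _ h => ⟨h, zero_mem _⟩⟩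
        inr := ⟨LinearMap.inr A M N, fun _ _ h => ⟨zero_mem _, h⟩⟩
        inl_fst := rfl
        inl_snd := rfl
        inr_fst := rfl
        inr_snd := rfl }
      (hom_ext fun x => Prod.ext (add_zero x.1) (zero_add x.2))⟩
  hasFiniteProducts_of_has_binary_and_terminal

section Kernels

variable {M N : GrMod 𝒜} (f : M ⟶ N)

theorem isGradedSub_ker : M.IsGradedSub (LinearMap.ker f.lin) := fun i x hx => by
  rw [LinearMap.mem_ker] at hx ⊢
  rw [map_proj, hx, map_zero]

theorem isGradedSub_range : N.IsGradedSub (LinearMap.range f.lin) := by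
  rintro i _ ⟨x, rfl⟩
  exact ⟨_, map_proj f i x⟩

/-- The inclusion of a graded submodule. -/
def subι (M : GrMod 𝒜) (P : Submodule A M) (hP : M.IsGradedSub P) : M.sub P hP ⟶ M :=
  ⟨P.subtype, fun _ _ h => h⟩

/-- The projection onto a graded quotient. -/
def quotπ (M : GrMod 𝒜) (P : Submodule A M) (hP : M.IsGradedSub P) : M ⟶ M.quot P hP :=
  ⟨P.mkQ, fun _ x h => ⟨x, h, rfl⟩⟩

theorem lin_of_comp_eq_zero {P : GrMod 𝒜} {f : M ⟶ N} {g : N ⟶ P} (h : f ≫ g = 0) (x : M) :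
    g.lin (f.lin x) = 0 :=
  LinearMap.congr_fun (congrArg Hom.lin h) x

theorem ker_condition : subι M _ (isGradedSub_ker f) ≫ f = 0 :=
  hom_ext fun x => x.2

theorem coker_condition : f ≫ quotπ N _ (isGradedSub_range f) = 0 :=
  hom_ext fun x => (Submodule.Quotient.mk_eq_zero _).2 ⟨x, rfl⟩

instance : HasKernels (GrMod 𝒜) where
  has_limit f := ⟨⟨_, KernelFork.IsLimit.ofι (subι _ _ (isGradedSub_ker f)) (ker_condition f)
    (fun g hg => ⟨LinearMap.codRestrict _ g.lin (lin_of_comp_eq_zero hg),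
      fun i x h => g.map_deg i x h⟩)
    (fun _ _ => rfl)
    (fun _ _ _ hm => hom_ext fun x => Subtype.ext
      (LinearMap.congr_fun (congrArg Hom.lin hm) x))⟩⟩

instance : HasCokernels (GrMod 𝒜) where
  has_colimit f := ⟨⟨_, CokernelCofork.IsColimit.ofπ (quotπ _ _ (isGradedSub_range f))
    (coker_condition f)
    (fun g hg => ⟨Submodule.liftQ _ g.lin (by
        rintro _ ⟨x, rfl⟩
        exact lin_of_comp_eq_zero hg x), by
        rintro i _ ⟨x, hx, rfl⟩
        exact g.map_deg i x hx⟩)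
    (fun _ _ => rfl)
    (fun _ _ _ hm => hom_ext fun x => by
      obtain ⟨x, rfl⟩ := Submodule.mkQ_surjective _ x
      exact LinearMap.congr_fun (congrArg Hom.lin hm) x)⟩⟩

theorem injective_of_mono [Mono f] : Function.Injective f.lin := by
  rw [← LinearMap.ker_eq_bot, eq_bot_iff]
  intro x hx
  have h : subι M _ (isGradedSub_ker f) = 0 := by
    rw [← cancel_mono f, ker_condition, zero_comp]
  exact LinearMap.congr_fun (congrArg Hom.lin h) ⟨x, hx⟩

theorem surjective_of_epi [Epi f] : Function.Surjective f.lin := by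
  intro y
  have h : quotπ N _ (isGradedSub_range f) = 0 := by
    rw [← cancel_epi f, coker_condition, comp_zero]
  exact (Submodule.Quotient.mk_eq_zero _).1 (LinearMap.congr_fun (congrArg Hom.lin h) y)

theorem mem_deg_of_injective (hf : Function.Injective f.lin) {i : ι} {x : M}
    (hx : f.lin x ∈ N.deg i) : x ∈ M.deg i := by
  have h : f.lin (proj M.isInternal i x) = f.lin x := by
    rw [map_proj, proj_same N.isInternal hx]
  rw [← hf h]
  exact proj_mem _ _ _

theorem exists_deg_of_surjective (hf : Function.Surjective f.lin) {i : ι} {y : N}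
    (hy : y ∈ N.deg i) : ∃ x ∈ M.deg i, f.lin x = y := by
  obtain ⟨x, rfl⟩ := hf y
  exact ⟨_, proj_mem M.isInternal i x, by rw [map_proj, proj_same N.isInternal hy]⟩

/-- Every monomorphism is the kernel of its cokernel. -/
@[reducible]
noncomputable def normalMono [Mono f] : NormalMono f where
  Z := _
  g := quotπ N _ (isGradedSub_range f)
  w := coker_condition f
  isLimit :=
    have hf := injective_of_mono f
    have hr : ∀ {P : GrMod 𝒜} (g : P ⟶ N), g ≫ quotπ N _ (isGradedSub_range f) = 0 →
        ∀ x, g.lin x ∈ LinearMap.range f.lin := fun g hg x =>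
      (Submodule.Quotient.mk_eq_zero _).1 (lin_of_comp_eq_zero hg x)
    have hl : ∀ {P : GrMod 𝒜} (g : P ⟶ N) (hg : g ≫ quotπ N _ (isGradedSub_range f) = 0) (x),
        f.lin ((LinearEquiv.ofInjective f.lin hf).symm ⟨g.lin x, hr g hg x⟩) = g.lin x :=
      fun g hg x => congrArg Subtype.val
        ((LinearEquiv.ofInjective f.lin hf).apply_symm_apply ⟨g.lin x, hr g hg x⟩)
    KernelFork.IsLimit.ofι f (coker_condition f)
      (fun g hg => ⟨(LinearEquiv.ofInjective f.lin hf).symm.toLinearMap ∘ₗ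
          LinearMap.codRestrict _ g.lin (hr g hg), fun i x hx =>
          mem_deg_of_injective f hf (by
            have := g.map_deg i x hx
            rw [← hl g hg x] at this
            exact this)⟩)
      (fun g hg => hom_ext fun x => hl g hg x)
      (fun g hg m hm => hom_ext fun x => hf
        ((LinearMap.congr_fun (congrArg Hom.lin hm) x).trans (hl g hg x).symm))

/-- Every epimorphism is the cokernel of its kernel. -/
@[reducible]
noncomputable def normalEpi [Epi f] : NormalEpi f where
  W := _
  g := subι M _ (isGradedSub_ker f)
  w := ker_condition f
  isColimit :=
    have hf := surjective_of_epi f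
    have hk : ∀ {P : GrMod 𝒜} (g : M ⟶ P), subι M _ (isGradedSub_ker f) ≫ g = 0 →
        LinearMap.ker f.lin ≤ LinearMap.ker g.lin := fun g hg x hx =>
      LinearMap.congr_fun (congrArg Hom.lin hg) ⟨x, hx⟩
    have hl : ∀ {P : GrMod 𝒜} (g : M ⟶ P) (hg : subι M _ (isGradedSub_ker f) ≫ g = 0) (x),
        ((LinearMap.ker f.lin).liftQ g.lin (hk g hg))
          ((f.lin.quotKerEquivOfSurjective hf).symm (f.lin x)) = g.lin x := fun g hg x => by
      have : (f.lin.quotKerEquivOfSurjective hf).symm (f.lin x) = (LinearMap.ker f.lin).mkQ x := by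
        rw [LinearEquiv.symm_apply_eq]
        rfl
      rw [this]
      rfl
    CokernelCofork.IsColimit.ofπ f (ker_condition f)
      (fun g hg => ⟨(LinearMap.ker f.lin).liftQ g.lin (hk g hg) ∘ₗ
          (f.lin.quotKerEquivOfSurjective hf).symm.toLinearMap, fun i y hy => by
          obtain ⟨x, hx, rfl⟩ := exists_deg_of_surjective f hf hy
          have := g.map_deg i x hx
          rw [← hl g hg x] at this
          exact this⟩)
      (fun g hg => hom_ext fun x => hl g hg x)
      (fun g hg m hm => hom_ext fun y => by
        obtain ⟨x, rfl⟩ := hf y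
        exact (LinearMap.congr_fun (congrArg Hom.lin hm) x).trans (hl g hg x).symm)

end Kernels

noncomputable instance : Abelian (GrMod 𝒜) where
  normalMonoOfMono f _ := ⟨normalMono f⟩
  normalEpiOfEpi f _ := ⟨normalEpi f⟩

instance : HasExt.{u + 1} (GrMod 𝒜) := HasExt.standard _

/-! ### Shifts and coarsened gradings -/

/-- The shift `M(k)`, with `M(k)_i = M_(i + k)`. -/
def shift (M : GrMod 𝒜) (k : ι) : GrMod 𝒜 where
  carrier := M
  deg i := M.deg (i + k)
  isInternal := by
    refine isInternal_of_proj _ ?_ (fun i => proj M.isInternal (i + k))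
      (fun i x hx => proj_same M.isInternal hx)
      (fun i j hij x hx => proj_ne M.isInternal (fun h => hij (add_right_cancel h)) hx)
    intro x
    refine induction_proj M.isInternal (P := fun y => y ∈ AddSubmonoid.closure _) x (zero_mem _)
      (fun a b => add_mem) fun i => AddSubmonoid.subset_closure (Set.mem_iUnion.2 ⟨i - k, ?_⟩)
    change proj M.isInternal i x ∈ M.deg (i - k + k)
    rw [sub_add_cancel]
    exact proj_mem M.isInternal i x
  smul_mem i j a x ha hx := by
    rw [add_assoc]
    exact M.smul_mem i (j + k) a x ha hx

section Coarsen

variable {κ : Type} [DecidableEq κ] [AddCommGroup κ]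

/-- The grading of a ring by `κ` obtained from a grading by `ι` along `φ : ι →+ κ`:
the part of degree `n` is the sum of the parts of degree `i` with `φ i = n`. -/
def coarsenRing (𝒜 : ι → Submodule K A) (φ : ι →+ κ) (n : κ) : Submodule K A :=
  ⨆ i, ⨆ _ : φ i = n, 𝒜 i

set_option linter.unusedSectionVars false

theorem mem_coarsenRing {φ : ι →+ κ} {i : ι} {a : A} (ha : a ∈ 𝒜 i) :
    a ∈ coarsenRing 𝒜 φ (φ i) :=
  (le_iSup₂_of_le i rfl le_rfl : 𝒜 i ≤ coarsenRing 𝒜 φ (φ i)) ha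

theorem coarsenRing_le {φ : ι →+ κ} {n : κ} {S : AddSubmonoid A}
    (hS : ∀ i, φ i = n → ∀ a ∈ 𝒜 i, a ∈ S) {a : A} (ha : a ∈ coarsenRing 𝒜 φ n) : a ∈ S := by
  refine Submodule.iSup_induction _ (motive := (· ∈ S)) ha (fun i x hx => ?_) (zero_mem _)
    fun _ _ => add_mem
  by_cases h : φ i = n
  · rw [iSup_pos h] at hx
    exact hS i h x hx
  · rw [iSup_neg h, Submodule.mem_bot] at hx
    rw [hx]
    exact zero_mem _

/-- The same construction for the degrees of a graded module. -/
def coarsenDeg (M : GrMod 𝒜) (φ : ι →+ κ) (n : κ) : AddSubgroup M :=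
  ⨆ i, ⨆ _ : φ i = n, M.deg i

theorem mem_coarsenDeg {M : GrMod 𝒜} {φ : ι →+ κ} {i : ι} {x : M} (hx : x ∈ M.deg i) :
    x ∈ M.coarsenDeg φ (φ i) :=
  (le_iSup₂_of_le i rfl le_rfl : M.deg i ≤ M.coarsenDeg φ (φ i)) hx

theorem coarsenDeg_le {M : GrMod 𝒜} {φ : ι →+ κ} {n : κ} {S : AddSubmonoid M}
    (hS : ∀ i, φ i = n → ∀ x ∈ M.deg i, x ∈ S) {x : M} (hx : x ∈ M.coarsenDeg φ n) : x ∈ S := by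
  refine AddSubgroup.iSup_induction _ (C := (· ∈ S)) hx (fun i x hx => ?_) (zero_mem _)
    fun _ _ => add_mem
  by_cases h : φ i = n
  · rw [iSup_pos h] at hx
    exact hS i h x hx
  · rw [iSup_neg h, AddSubgroup.mem_bot] at hx
    rw [hx]
    exact zero_mem _

/-- A graded module, with its grading coarsened along `φ`. -/
def coarsen (M : GrMod 𝒜) (φ : ι →+ κ) : GrMod (coarsenRing 𝒜 φ) where
  carrier := M
  deg := M.coarsenDeg φ
  isInternal := isInternal_fibres M.isInternal φ _ (fun _ _ => mem_coarsenDeg)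
    (fun _ _ h _ hx => coarsenDeg_le h hx)
  smul_mem m n a x ha hx := by
    refine coarsenRing_le (S := (M.coarsenDeg φ (m + n)).toAddSubmonoid.comap
      ((LinearMap.toSpanSingleton A M x).toAddMonoidHom)) (fun i hi a ha => ?_) ha
    refine coarsenDeg_le (S := (M.coarsenDeg φ (m + n)).toAddSubmonoid.comap
      (DistribSMul.toAddMonoidHom M a)) (fun j hj x hx => ?_) hx
    have := mem_coarsenDeg (φ := φ) (M.smul_mem i j a x ha hx)
    rwa [map_add, hi, hj] at this

/-- The coarsened grading of a graded ring is again a graded ring. -/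
noncomputable instance [GradedAlgebra 𝒜] (φ : ι →+ κ) : GradedAlgebra (coarsenRing 𝒜 φ) where
  one_mem := by
    have := mem_coarsenRing (φ := φ) (SetLike.GradedOne.one_mem (A := 𝒜))
    rwa [map_zero] at this
  mul_mem m n a b ha hb := by
    refine coarsenRing_le (S := (coarsenRing 𝒜 φ (m + n)).toAddSubmonoid.comap
      (AddMonoidHom.mulRight b)) (fun i hi a ha => ?_) ha
    refine coarsenRing_le (S := (coarsenRing 𝒜 φ (m + n)).toAddSubmonoid.comap
      (AddMonoidHom.mulLeft a)) (fun j hj b hb => ?_) hb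
    have := mem_coarsenRing (φ := φ) (SetLike.GradedMul.mul_mem (A := 𝒜) ha hb)
    rwa [map_add, hi, hj] at this
  toDecomposition := DirectSum.IsInternal.chooseDecomposition _
    (isInternal_fibres (DirectSum.Decomposition.isInternal 𝒜) φ _ (fun _ _ => mem_coarsenRing)
      (fun _ _ h _ hx => coarsenRing_le h hx))

end Coarsen

/-! ### Graded local cohomology -/

section LocalCohomology

variable (𝒜) [GradedAlgebra 𝒜]

/-- A graded ring as a graded module over itself. -/
def self : GrMod 𝒜 where
  carrier := A
  deg i := (𝒜 i).toAddSubgroup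
  isInternal := DirectSum.Decomposition.isInternal 𝒜
  smul_mem _ _ _ _ ha hx := SetLike.GradedMul.mul_mem ha hx

variable {𝒜}

theorem isGradedSub_pow {I : Ideal A} (hI : I.IsHomogeneous 𝒜) (t : ℕ) :
    (self 𝒜).IsGradedSub (I ^ t : Ideal A) := by
  have h : (I ^ t).IsHomogeneous 𝒜 := by
    induction t with
    | zero =>
      rw [pow_zero, Ideal.one_eq_top]
      exact fun _ _ _ => trivial
    | succ t ih =>
      rw [pow_succ]
      exact ih.mul hI
  intro i x hx
  have e : proj (self 𝒜).isInternal i x = (DirectSum.decompose 𝒜 x i : A) := by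
    clear hx
    induction x using DirectSum.Decomposition.inductionOn 𝒜 with
    | zero =>
      rw [DirectSum.decompose_zero]
      exact map_zero (proj (self 𝒜).isInternal i)
    | @homogeneous j y =>
      by_cases hij : j = i
      · subst hij
        rw [DirectSum.decompose_of_mem_same 𝒜 y.2]
        exact proj_same (self 𝒜).isInternal y.2
      · rw [DirectSum.decompose_of_mem_ne 𝒜 y.2 hij]
        exact proj_ne (self 𝒜).isInternal hij y.2
    | add a b ha hb =>
      rw [DirectSum.decompose_add, DirectSum.add_apply, Submodule.coe_add, ← ha, ← hb]
      exact map_add (proj (self 𝒜).isInternal i) a b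
  rw [e]
  exact h i hx

/-- The graded module `A / I ^ t`, for a homogeneous ideal `I`. -/
def quotPow {I : Ideal A} (hI : I.IsHomogeneous 𝒜) (t : ℕ) : GrMod 𝒜 :=
  (self 𝒜).quot (I ^ t : Ideal A) (isGradedSub_pow hI t)

/-- The projection `A / I ^ t → A / I ^ s`, for `s ≤ t`. -/
def quotPowMap {I : Ideal A} (hI : I.IsHomogeneous 𝒜) {s t : ℕ} (h : s ≤ t) :
    quotPow hI t ⟶ quotPow hI s where
  lin := Submodule.mapQ (I ^ t : Ideal A) (I ^ s : Ideal A) LinearMap.id (Ideal.pow_le_pow_right h)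
  map_deg := by
    rintro i _ ⟨x, hx, rfl⟩
    exact ⟨x, hx, rfl⟩

/-- `H^i_I(M)_k`, the degree `k` part of the `i`-th graded local cohomology of `M` with support in
the homogeneous ideal `I`: the direct limit over `t` of the groups `Ext^i(A / I ^ t, M(k))`,
computed in the category of graded modules. -/
def LocalCohomology {I : Ideal A} (hI : I.IsHomogeneous 𝒜) (M : GrMod 𝒜) (i : ℕ)
    (k : ι) : Type (u + 1) :=
  AddCommGroup.DirectLimit (fun t : ℕ => Abelian.Ext (quotPow hI t) (M.shift k) i)
    fun _ _ h => (Abelian.Ext.mk₀ (quotPowMap hI h)).precomp (M.shift k) (zero_add i)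

noncomputable instance {I : Ideal A} (hI : I.IsHomogeneous 𝒜) (M : GrMod 𝒜) (i : ℕ) (k : ι) :
    AddCommGroup (LocalCohomology hI M i k) :=
  inferInstanceAs (AddCommGroup (AddCommGroup.DirectLimit _ _))

end LocalCohomology

end GrMod

/-! ### Bigraded modules over a bigraded polynomial ring -/

namespace Bigraded

/-- The ring `K[x_0, …, x_m, y_0, …, y_n]`. -/
abbrev Ring (K : Type u) [Field K] (m n : ℕ) : Type u :=
  MvPolynomial (Fin (m + 1) ⊕ Fin (n + 1)) K

/-- The variables `x_i` have bidegree `(1, 0)`, the variables `y_j` have bidegree `(0, 1)`. -/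
def weight (m n : ℕ) : Fin (m + 1) ⊕ Fin (n + 1) → ℤ × ℤ :=
  Sum.elim (fun _ => (1, 0)) (fun _ => (0, 1))

variable (K : Type u) [Field K] (m n : ℕ)

/-- The part `R_(a, b)` of bidegree `(a, b)` of the polynomial ring. -/
noncomputable def bideg : ℤ × ℤ → Submodule K (Ring K m n) :=
  MvPolynomial.weightedHomogeneousSubmodule K (weight m n)

noncomputable instance : GradedAlgebra (bideg K m n) :=
  MvPolynomial.weightedGradedAlgebra K (weight m n)

/-- The map `(a, b) ↦ a + b` from bidegrees to total degrees. -/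
def total : ℤ × ℤ →+ ℤ := AddMonoidHom.coprod (AddMonoidHom.id ℤ) (AddMonoidHom.id ℤ)

/-- The ideal `(x) = (x_0, …, x_m)`. -/
noncomputable def idealX : Ideal (Ring K m n) :=
  Ideal.span (Set.range fun i => MvPolynomial.X (Sum.inl i))

/-- The ideal `(y) = (y_0, …, y_n)`. -/
noncomputable def idealY : Ideal (Ring K m n) :=
  Ideal.span (Set.range fun j => MvPolynomial.X (Sum.inr j))

/-- The ideal `(x, y) = (x_0, …, x_m, y_0, …, y_n)`. -/
noncomputable def idealXY : Ideal (Ring K m n) :=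
  Ideal.span (Set.range MvPolynomial.X)

theorem X_mem (s : Fin (m + 1) ⊕ Fin (n + 1)) :
    (MvPolynomial.X s : Ring K m n) ∈ bideg K m n (weight m n s) :=
  MvPolynomial.isWeightedHomogeneous_X K (weight m n) s

theorem idealX_homogeneous : (idealX K m n).IsHomogeneous (bideg K m n) :=
  Ideal.homogeneous_span _ _ (by
    rintro _ ⟨i, rfl⟩
    exact ⟨_, X_mem K m n _⟩)

theorem idealY_homogeneous : (idealY K m n).IsHomogeneous (bideg K m n) :=
  Ideal.homogeneous_span _ _ (by
    rintro _ ⟨j, rfl⟩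
    exact ⟨_, X_mem K m n _⟩)

theorem idealXY_homogeneous :
    (idealXY K m n).IsHomogeneous (GrMod.coarsenRing (bideg K m n) total) :=
  Ideal.homogeneous_span _ _ (by
    rintro _ ⟨s, rfl⟩
    exact ⟨_, GrMod.mem_coarsenRing (X_mem K m n s)⟩)

variable {K m n}

/-- The vanishing condition `VC_d(p, p')` for a bigraded module `M`. In the last clause the ring
and the module are graded by total degree. -/
def VC (d : ℕ) (p p' : ℤ) (M : GrMod (bideg K m n)) : Prop :=
  ∀ i : ℕ,
    (∀ k k' : ℤ, p + d + 1 - i ≤ k →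
      Subsingleton (GrMod.LocalCohomology (idealX_homogeneous K m n) M i (k, k'))) ∧
    (∀ k k' : ℤ, p' + d + 1 - i ≤ k' →
      Subsingleton (GrMod.LocalCohomology (idealY_homogeneous K m n) M i (k, k'))) ∧
    (∀ k k' : ℤ, p + p' + d + 1 - i ≤ k + k' →
      Subsingleton (GrMod.LocalCohomology (idealXY_homogeneous K m n) (M.coarsen total) i
        (k + k')))

/-- Strong `(p, p')`-regularity of a bigraded module. -/
def StronglyRegular (p p' : ℤ) (M : GrMod (bideg K m n)) : Prop :=
  VC 0 p p' M

end Bigraded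

/-!
The powers `x_s ^ t` of the variables in a finite set `S` form a regular sequence in the
polynomial ring `A`, so for `J = (x_s ^ t : s ∈ S)` the only nonzero `Ext^i(A / J, A)` is the one
with `i = #S`, and it is `A / J`, with a shift of degrees by `∑ t • deg x_s`.  Concretely,
multiplication by a nonzerodivisor `z` of degree `e` on `A / J` gives short exact sequences
`0 → (A / J)(l - e) → (A / J)(l) → (A / (J + z))(l) → 0`, and their long exact `Ext` sequences
move the nonzero `Ext` up by one and divide it by `z`.  To run this as an induction one has to know
how `z` acts on the `Ext` groups already computed.  The structure `GrMod.TopExt` therefore records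
an explicit surjection from a graded piece of `A` onto the nonzero `Ext`, for all shifts `l` at
once, with kernel given by `J` and compatible with multiplication by homogeneous elements;
`GrMod.TopExt.bot` is the case `J = 0`, where `A(l)` is projective, and `GrMod.TopExt.step` is the
induction step, in which the compatibility is naturality of the connecting homomorphism.

For `I = (x_s : s ∈ S)` the ideals `(x_s ^ t)` are cofinal with the powers of `I`, so that every
class in `Ext^i(A / I ^ t, A(k))` is killed further along the direct system as soon as
`Ext^i(A / (x_s ^ t), A(k)) = 0` for all `t`.  This holds for `i ≠ #S`.  For `i = #S` it says that
every polynomial of degree `k + ∑ t • deg x_s` lies in `(x_s ^ t)`, which, by the pigeonhole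
principle, holds as soon as its monomials have degree greater than `#S * (t - 1)` in the variables
of `S`; for `i = #S` the degrees in the definition of strong regularity satisfy this.  The
three sets `S` are the variables `x`, the variables `y`, and all variables; for the last one the
ring is graded by total degree.
-/

namespace GrMod

variable {K : Type u} {A : Type u} {ι : Type} [CommRing K] [CommRing A] [Algebra K A]
  [DecidableEq ι] [AddCommGroup ι] {𝒜 : ι → Submodule K A}

/-! ### Exactness in the category of graded modules -/

section Exactness

variable {M N : GrMod 𝒜} (f : M ⟶ N)

theorem mono_of_injective (hf : Function.Injective f.lin) : Mono f :=
  ⟨fun _ _ e => hom_ext fun x => hf (LinearMap.congr_fun (congrArg Hom.lin e) x)⟩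

theorem epi_of_surjective (hf : Function.Surjective f.lin) : Epi f :=
  ⟨fun _ _ e => hom_ext fun y => by
    obtain ⟨x, rfl⟩ := hf y
    exact LinearMap.congr_fun (congrArg Hom.lin e) x⟩

theorem shortExact_of_lin (S : ShortComplex (GrMod 𝒜)) (hf : Function.Injective S.f.lin)
    (hg : Function.Surjective S.g.lin) (he : ∀ x, S.g.lin x = 0 → ∃ y, S.f.lin y = x) :
    S.ShortExact where
  mono_f := mono_of_injective _ hf
  epi_g := epi_of_surjective _ hg
  exact := by
    have hr : ∀ {P : GrMod 𝒜} (h : P ⟶ S.X₂), h ≫ S.g = 0 →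
        ∀ x, h.lin x ∈ LinearMap.range S.f.lin := fun h hh x =>
      he _ (lin_of_comp_eq_zero hh x)
    have hl : ∀ {P : GrMod 𝒜} (h : P ⟶ S.X₂) (hh : h ≫ S.g = 0) (x),
        S.f.lin ((LinearEquiv.ofInjective S.f.lin hf).symm ⟨h.lin x, hr h hh x⟩) = h.lin x :=
      fun h hh x => congrArg Subtype.val
        ((LinearEquiv.ofInjective S.f.lin hf).apply_symm_apply ⟨h.lin x, hr h hh x⟩)
    exact S.exact_of_f_is_kernel <| KernelFork.IsLimit.ofι S.f S.zero
      (fun h hh => ⟨(LinearEquiv.ofInjective S.f.lin hf).symm.toLinearMap ∘ₗ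
          LinearMap.codRestrict _ h.lin (hr h hh), fun i x hx =>
          mem_deg_of_injective S.f hf (by
            have := h.map_deg i x hx
            rw [← hl h hh x] at this
            exact this)⟩)
      (fun h hh => hom_ext fun x => hl h hh x)
      (fun h hh m hm => hom_ext fun x => hf
        ((LinearMap.congr_fun (congrArg Hom.lin hm) x).trans (hl h hh x).symm))

end Exactness

/-! ### Shifted cyclic modules and maps between them -/

variable [GradedAlgebra 𝒜]

theorem isGradedSub_of_isHomogeneous {J : Ideal A} (hJ : J.IsHomogeneous 𝒜) :
    (self 𝒜).IsGradedSub J := by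
  have h := isGradedSub_pow hJ 1
  rwa [pow_one] at h

/-- The graded module `(A / J)(l)`, for a homogeneous ideal `J`. -/
def quotShift {J : Ideal A} (hJ : J.IsHomogeneous 𝒜) (l : ι) : GrMod 𝒜 :=
  ((self 𝒜).quot J (isGradedSub_of_isHomogeneous hJ)).shift l

/-- The projection `A(l) → (A / J)(l)`. -/
def toQuotShift {J : Ideal A} (hJ : J.IsHomogeneous 𝒜) (l : ι) : A →ₗ[A] quotShift hJ l :=
  Submodule.mkQ J

theorem toQuotShift_surjective {J : Ideal A} (hJ : J.IsHomogeneous 𝒜) (l : ι) :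
    Function.Surjective (toQuotShift hJ l) := Submodule.mkQ_surjective _

theorem toQuotShift_eq_zero {J : Ideal A} (hJ : J.IsHomogeneous 𝒜) {l : ι} {x : A} :
    toQuotShift hJ l x = 0 ↔ x ∈ J := Submodule.Quotient.mk_eq_zero _

theorem mem_quotShift_deg {J : Ideal A} (hJ : J.IsHomogeneous 𝒜) {l i : ι}
    {y : quotShift hJ l} :
    y ∈ (quotShift hJ l).deg i ↔ ∃ x ∈ 𝒜 (i + l), toQuotShift hJ l x = y := Iff.rfl

/-- The morphism `(A / J)(l') → (A / J')(l)` induced by multiplication by an element `a` of degree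
`e` with `a J ⊆ J'`, where `l' + e = l`. -/
def mulMap {J J' : Ideal A} (hJ : J.IsHomogeneous 𝒜) (hJ' : J'.IsHomogeneous 𝒜) {l l' e : ι}
    {a : A} (ha : a ∈ 𝒜 e) (hl : l' + e = l) (h : ∀ x ∈ J, a * x ∈ J') :
    quotShift hJ l' ⟶ quotShift hJ' l where
  lin := Submodule.mapQ J J' (LinearMap.mulLeft A a) h
  map_deg := by
    rintro i _ ⟨(x : A), hx, rfl⟩
    refine ⟨a * x, ?_, rfl⟩
    change a * x ∈ 𝒜 (i + l)
    have := SetLike.GradedMul.mul_mem ha (show x ∈ 𝒜 (i + l') from hx)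
    rwa [show e + (i + l') = i + l by rw [← hl]; abel] at this

theorem quotShift_hom_ext {J : Ideal A} (hJ : J.IsHomogeneous 𝒜) {l : ι} {M : GrMod 𝒜}
    {f g : quotShift hJ l ⟶ M}
    (h : ∀ x, f.lin (toQuotShift hJ l x) = g.lin (toQuotShift hJ l x)) : f = g :=
  hom_ext fun y => by
    obtain ⟨x, rfl⟩ := toQuotShift_surjective hJ l y
    exact h x

theorem isHomogeneous_bot : (⊥ : Ideal A).IsHomogeneous 𝒜 := Ideal.IsHomogeneous.bot 𝒜

/-- The morphism `A(l) → M` given by an element of degree `-l`; here `A(l)` is written as the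
quotient by the zero ideal. -/
def freeDesc {M : GrMod 𝒜} {l c : ι} {x : M} (hx : x ∈ M.deg c) (hc : c + l = 0) :
    quotShift (isHomogeneous_bot (𝒜 := 𝒜)) l ⟶ M where
  lin := Submodule.liftQ (⊥ : Ideal A) (LinearMap.toSpanSingleton A M x) (bot_le (α := Ideal A))
  map_deg := by
    rintro i _ ⟨a, ha, rfl⟩
    have := M.smul_mem _ _ a x (show a ∈ 𝒜 (i + l) from ha) hx
    rwa [show i + l + c = i by rw [add_assoc, add_comm l, hc, add_zero]] at this

theorem freeDesc_lin {M : GrMod 𝒜} {l c : ι} {x : M} (hx : x ∈ M.deg c)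
    (hc : c + l = 0) (a : A) :
    (freeDesc hx hc).lin (toQuotShift (isHomogeneous_bot (𝒜 := 𝒜)) l a) = a • x := rfl

instance (l : ι) : Projective (quotShift (isHomogeneous_bot (𝒜 := 𝒜)) l) where
  factors {E X} f e _ := by
    have h1 : toQuotShift isHomogeneous_bot l (1 : A) ∈
        (quotShift (isHomogeneous_bot (𝒜 := 𝒜)) l).deg (-l) :=
      (mem_quotShift_deg _).2 ⟨1, by
        rw [neg_add_cancel]
        exact SetLike.GradedOne.one_mem, rfl⟩
    obtain ⟨x, hx, hxf⟩ := exists_deg_of_surjective e (surjective_of_epi e) (f.map_deg _ _ h1)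
    refine ⟨freeDesc hx (neg_add_cancel l), quotShift_hom_ext _ fun a => ?_⟩
    rw [comp_lin, LinearMap.comp_apply, freeDesc_lin, map_smul, hxf, ← map_smul, ← map_smul,
      smul_eq_mul, mul_one]

/-! ### `Ext` of quotients by regular sequences -/

open Abelian

/-- The graded modules `Ext^i((A / J)(l), A(k))` vanish for `i ≠ j`, and `Ext^j((A / J)(l), A(k))`
is the part of degree `k + d - l` of `A / J`, compatibly with multiplication by
homogeneous elements. The latter is recorded as a surjection `toExt` from the part of degree `c` of
`A` with kernel `J`. The degree `c` is a free variable subject to `c + l = k + d`, which avoids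
transport along equalities of degrees when `l` changes. The compatibility `mul_comp` concerns
multiplication by `a` as a map `(A / J)(l') → (A / J)(l)`. -/
structure TopExt {J : Ideal A} (hJ : J.IsHomogeneous 𝒜) (k d : ι) (j : ℕ) where
  subsingleton : ∀ (l : ι) (i : ℕ), i ≠ j →
    Subsingleton (Ext (quotShift hJ l) ((self 𝒜).shift k) i)
  toExt : ∀ {l c : ι}, c + l = k + d → 𝒜 c →+ Ext (quotShift hJ l) ((self 𝒜).shift k) j
  surjective : ∀ {l c : ι} (h : c + l = k + d), Function.Surjective (toExt h)
  eq_zero_iff : ∀ {l c : ι} (h : c + l = k + d) (x : 𝒜 c), toExt h x = 0 ↔ (x : A) ∈ J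
  mul_comp : ∀ {l c l' c' e : ι} (h : c + l = k + d) (h' : c' + l' = k + d) {a : A}
    (ha : a ∈ 𝒜 e) (hl : l' + e = l) (x : 𝒜 c) (y : 𝒜 c'), (y : A) = a * x →
    (Ext.mk₀ (mulMap hJ hJ ha hl fun _ => J.mul_mem_left a)).comp (toExt h x) (zero_add j) =
      toExt h' y

/-- Over the ring itself only `Hom(A(l), A(k)) = A_(k - l)` survives. -/
noncomputable def TopExt.bot (k : ι) : TopExt (isHomogeneous_bot (𝒜 := 𝒜)) k 0 0 where
  subsingleton l i hi := by
    obtain ⟨i, rfl⟩ := Nat.exists_eq_succ_of_ne_zero hi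
    exact Ext.subsingleton_of_projective _ _ i
  toExt {l c} h :=
    { toFun := fun x => Ext.mk₀ (freeDesc (M := (self 𝒜).shift k) (l := l) (c := c - k)
        (x := (x : A)) (by
          change (x : A) ∈ 𝒜 (c - k + k)
          rw [sub_add_cancel]
          exact x.2) (by rw [sub_add_eq_add_sub, h, add_zero, sub_self]))
      map_zero' := by
        rw [← Ext.mk₀_zero]
        exact congrArg _ (quotShift_hom_ext _ fun a => smul_zero a)
      map_add' := fun x y => by
        rw [← Ext.mk₀_add]
        exact congrArg _ (quotShift_hom_ext _ fun a => smul_add a (x : A) (y : A)) }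
  surjective {l c} h y := by
    obtain ⟨f, rfl⟩ := (Ext.mk₀_bijective _ _).2 y
    have h1 : toQuotShift isHomogeneous_bot l (1 : A) ∈
        (quotShift (isHomogeneous_bot (𝒜 := 𝒜)) l).deg (-l) :=
      (mem_quotShift_deg _).2 ⟨1, by
        rw [neg_add_cancel]
        exact SetLike.GradedOne.one_mem, rfl⟩
    have h2 : f.lin (toQuotShift isHomogeneous_bot l (1 : A)) ∈ 𝒜 (-l + k) := f.map_deg _ _ h1
    rw [show -l + k = c by rw [add_zero] at h; rw [← h]; abel] at h2
    refine ⟨⟨_, h2⟩, congrArg Ext.mk₀ (quotShift_hom_ext _ fun a => ?_)⟩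
    change a • f.lin (toQuotShift isHomogeneous_bot l (1 : A)) = _
    rw [← map_smul, ← map_smul, smul_eq_mul, mul_one]
  eq_zero_iff {l c} h x := by
    refine (Ext.mk₀_eq_zero_iff _).trans ⟨fun hx => ?_, fun hx => ?_⟩
    · have : (1 : A) • (x : A) = 0 := LinearMap.congr_fun (congrArg Hom.lin hx)
        (toQuotShift isHomogeneous_bot l (1 : A))
      rwa [one_smul] at this
    · refine quotShift_hom_ext _ fun a => ?_
      change a • (x : A) = 0
      rw [(Submodule.mem_bot A).1 hx, smul_zero]
  mul_comp {l c l' c' e} h h' a ha hl x y hy := by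
    change (Ext.mk₀ _).comp (Ext.mk₀ _) _ = Ext.mk₀ _
    rw [Ext.mk₀_comp_mk₀]
    refine congrArg _ (quotShift_hom_ext _ fun b => ?_)
    change (a * b) • (x : A) = b • (y : A)
    rw [hy, smul_eq_mul, smul_eq_mul]
    ring

/-- Multiplication by an element `z` of degree `e` gives
`0 → (A / J)(l') → (A / J)(l) → (A / (J + z))(l) → 0`. The projection is written as multiplication
by `1`. The ideal `J'` and the shift `l'` are free variables subject to equations. -/
abbrev mulComplex {J J' : Ideal A} (hJ : J.IsHomogeneous 𝒜) (hJ' : J'.IsHomogeneous 𝒜) {e : ι}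
    {z : A} (hz : z ∈ 𝒜 e) (hJJ' : J' = J ⊔ Ideal.span {z}) {l l' : ι} (hl : l' + e = l) :
    ShortComplex (GrMod 𝒜) where
  X₁ := quotShift hJ l'
  X₂ := quotShift hJ l
  X₃ := quotShift hJ' l
  f := mulMap hJ hJ hz hl fun _ => J.mul_mem_left z
  g := mulMap hJ hJ' SetLike.GradedOne.one_mem (add_zero l)
    fun x hx => by
      rw [one_mul, hJJ']
      exact Ideal.mem_sup_left hx
  zero := quotShift_hom_ext _ fun x => by
    change toQuotShift hJ' l (1 * (z * x)) = 0
    rw [toQuotShift_eq_zero, hJJ', one_mul]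
    exact Ideal.mem_sup_right (Ideal.mul_mem_right _ _ (Ideal.mem_span_singleton_self z))

theorem mulComplex_shortExact {J J' : Ideal A} (hJ : J.IsHomogeneous 𝒜)
    (hJ' : J'.IsHomogeneous 𝒜) {e : ι} {z : A} (hz : z ∈ 𝒜 e) (hJJ' : J' = J ⊔ Ideal.span {z})
    (hreg : ∀ x, z * x ∈ J → x ∈ J) {l l' : ι} (hl : l' + e = l) :
    (mulComplex hJ hJ' hz hJJ' hl).ShortExact := by
  refine shortExact_of_lin _ ?_ ?_ ?_
  · rw [injective_iff_map_eq_zero]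
    intro x hx
    obtain ⟨x, rfl⟩ := toQuotShift_surjective hJ l' x
    exact (toQuotShift_eq_zero hJ).2 (hreg x ((toQuotShift_eq_zero hJ).1 hx))
  · intro y
    obtain ⟨x, rfl⟩ := toQuotShift_surjective hJ' l y
    refine ⟨toQuotShift hJ l x, ?_⟩
    change toQuotShift hJ' l (1 * x) = _
    rw [one_mul]
  · intro x hx
    obtain ⟨x, rfl⟩ := toQuotShift_surjective hJ l x
    have hx' : 1 * x ∈ J' := (toQuotShift_eq_zero hJ').1 hx
    rw [one_mul, hJJ'] at hx'
    obtain ⟨u, hu, v, hv, rfl⟩ := Submodule.mem_sup.1 hx'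
    obtain ⟨y, rfl⟩ := Ideal.mem_span_singleton'.1 hv
    refine ⟨toQuotShift hJ l' y, ?_⟩
    change toQuotShift hJ l (z * y) = _
    rw [map_add, (toQuotShift_eq_zero hJ).2 hu, zero_add, mul_comm]

/-- A homogeneous element of `J + (z)` is a multiple of `z` by a homogeneous element, modulo `J`. -/
theorem exists_mem_of_mem_sup_span {J : Ideal A} (hJ : J.IsHomogeneous 𝒜) {e c c' : ι} {z x : A}
    (hz : z ∈ 𝒜 e) (hc : e + c' = c) (hx : x ∈ 𝒜 c) (hxJ : x ∈ J ⊔ Ideal.span {z}) :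
    ∃ y ∈ 𝒜 c', x - z * y ∈ J := by
  obtain ⟨u, hu, v, hv, huv⟩ := Submodule.mem_sup.1 hxJ
  obtain ⟨y, rfl⟩ := Ideal.mem_span_singleton.1 hv
  refine ⟨(DirectSum.decompose 𝒜 y c' : A), SetLike.coe_mem _, ?_⟩
  have h : (DirectSum.decompose 𝒜 u c : A) + z * (DirectSum.decompose 𝒜 y c' : A) = x := by
    rw [← DirectSum.coe_decompose_mul_add_of_left_mem 𝒜 hz, hc, ← Submodule.coe_add,
      ← DirectSum.add_apply, ← DirectSum.decompose_add, huv, DirectSum.decompose_of_mem_same 𝒜 hx]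
  rw [← h, add_sub_cancel_right]
  exact hJ c hu

/-- Multiplication by a homogeneous element `a`, as a morphism between the short exact sequences
given by multiplication by `z`. -/
def mulComplexMap {J J' : Ideal A} (hJ : J.IsHomogeneous 𝒜) (hJ' : J'.IsHomogeneous 𝒜) {e : ι}
    {z : A} (hz : z ∈ 𝒜 e) (hJJ' : J' = J ⊔ Ideal.span {z}) {l₁ l₁' l₂ l₂' b : ι}
    (hl₁ : l₁' + e = l₁) (hl₂ : l₂' + e = l₂) {a : A} (ha : a ∈ 𝒜 b) (hl : l₁ + b = l₂) :
    mulComplex hJ hJ' hz hJJ' hl₁ ⟶ mulComplex hJ hJ' hz hJJ' hl₂ where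
  τ₁ := mulMap hJ hJ ha (add_right_cancel (b := e) (by rw [hl₂, ← hl, ← hl₁]; abel))
    fun _ => J.mul_mem_left a
  τ₂ := mulMap hJ hJ ha hl fun _ => J.mul_mem_left a
  τ₃ := mulMap hJ' hJ' ha hl fun _ => J'.mul_mem_left a
  comm₁₂ := quotShift_hom_ext hJ fun x => by
    change toQuotShift hJ l₂ (z * (a * x)) = toQuotShift hJ l₂ (a * (z * x))
    rw [mul_left_comm]
  comm₂₃ := quotShift_hom_ext hJ fun x => by
    change toQuotShift hJ' l₂ (1 * (a * x)) = toQuotShift hJ' l₂ (a * (1 * x))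
    rw [mul_left_comm]

section Step

variable {J J' : Ideal A} {hJ : J.IsHomogeneous 𝒜} {k d e : ι} {j : ℕ} {z : A}

/-- Pullback along `z : (A / J)(l') → (A / J)(l)` is injective on `Ext^j`, because `Ext^j` is a part
of `A / J`, on which `z` is a nonzerodivisor. -/
theorem TopExt.mul_injective (T : TopExt hJ k d j) (hz : z ∈ 𝒜 e)
    (hreg : ∀ x, z * x ∈ J → x ∈ J) {l l' : ι} (hl : l' + e = l)
    (x : Ext (quotShift hJ l) ((self 𝒜).shift k) j)
    (hx : (Ext.mk₀ (mulMap hJ hJ hz hl fun _ => J.mul_mem_left z)).comp x (zero_add j) = 0) :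
    x = 0 := by
  have h : k + d - l + l = k + d := sub_add_cancel _ _
  obtain ⟨w, rfl⟩ := T.surjective h x
  have hzw := SetLike.GradedMul.mul_mem hz w.2
  rw [T.mul_comp h (c' := e + (k + d - l)) (by rw [← hl]; abel) hz hl w ⟨_, hzw⟩ rfl,
    T.eq_zero_iff] at hx
  exact (T.eq_zero_iff h w).2 (hreg _ hx)

/-- The map `A_c → Ext^(j + 1)((A / J')(l), A(k))`, for `J' = J + (z)`, obtained from the
connecting homomorphism of multiplication by `z`. -/
noncomputable def TopExt.connect (T : TopExt hJ k d j) (hJ' : J'.IsHomogeneous 𝒜) (hz : z ∈ 𝒜 e)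
    (hreg : ∀ x, z * x ∈ J → x ∈ J) (hJJ' : J' = J ⊔ Ideal.span {z}) {l l' c : ι}
    (hl : l' + e = l) (h : c + l' = k + d) :
    𝒜 c →+ Ext (quotShift hJ' l) ((self 𝒜).shift k) (j + 1) :=
  ((mulComplex_shortExact hJ hJ' hz hJJ' hreg hl).extClass.precomp _
    (add_comm 1 j)).comp (T.toExt h)

/-- Naturality of the connecting homomorphism makes `TopExt.connect` compatible with multiplication
by homogeneous elements. -/
theorem TopExt.mul_comp_connect (T : TopExt hJ k d j) (hJ' : J'.IsHomogeneous 𝒜) (hz : z ∈ 𝒜 e)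
    (hreg : ∀ x, z * x ∈ J → x ∈ J) (hJJ' : J' = J ⊔ Ideal.span {z}) {l₁ l₁' l₂ l₂' c₁ c₂ b : ι}
    (hl₁ : l₁' + e = l₁) (hl₂ : l₂' + e = l₂) (h₁ : c₁ + l₁' = k + d) (h₂ : c₂ + l₂' = k + d)
    {a : A} (ha : a ∈ 𝒜 b) (hl : l₁ + b = l₂) (x : 𝒜 c₂) (y : 𝒜 c₁) (hy : (y : A) = a * x) :
    (Ext.mk₀ (mulMap hJ' hJ' ha hl fun _ => J'.mul_mem_left a)).comp
        (T.connect hJ' hz hreg hJJ' hl₂ h₂ x) (zero_add (j + 1)) =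
      T.connect hJ' hz hreg hJJ' hl₁ h₁ y := by
  have hS₁ := mulComplex_shortExact hJ hJ' hz hJJ' hreg hl₁
  have hS₂ := mulComplex_shortExact hJ hJ' hz hJJ' hreg hl₂
  have hl' : l₁' + b = l₂' := add_right_cancel (b := e) (by rw [hl₂, ← hl, ← hl₁]; abel)
  have key := ShortComplex.ShortExact.extClass_naturality hS₁ hS₂
    (mulComplexMap hJ hJ' hz hJJ' hl₁ hl₂ ha hl)
  have hm := T.mul_comp h₂ h₁ ha hl' x y hy
  have e1 := Ext.comp_assoc (Ext.mk₀ (mulComplexMap hJ hJ' hz hJJ' hl₁ hl₂ ha hl).τ₃) hS₂.extClass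
    (T.toExt h₂ x) (zero_add 1) (add_comm 1 j) (a := j + 1) (by omega)
  have e2 := Ext.comp_assoc hS₁.extClass (Ext.mk₀ (mulComplexMap hJ hJ' hz hJJ' hl₁ hl₂ ha hl).τ₁)
    (T.toExt h₂ x) (add_zero 1) (zero_add j) (a := j + 1) (by omega)
  rw [key] at e2
  exact (e1.symm.trans e2).trans
    (congrArg (fun v => hS₁.extClass.comp v (add_comm 1 j)) hm)

/-- Passing from `A / J` to `A / (J + z)`, for a homogeneous nonzerodivisor `z` on `A / J`, raises
the only degree with a nonzero `Ext` by one, and `Ext^(j + 1)` is the cokernel of `z` on `Ext^j`;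
the identification with `A / (J + z)` is the connecting homomorphism. -/
noncomputable def TopExt.step (T : TopExt hJ k d j) (hJ' : J'.IsHomogeneous 𝒜) (hz : z ∈ 𝒜 e)
    (hreg : ∀ x, z * x ∈ J → x ∈ J) (hJJ' : J' = J ⊔ Ideal.span {z}) :
    TopExt hJ' k (d + e) (j + 1) where
  subsingleton l i hi := by
    have hl : l - e + e = l := sub_add_cancel l e
    have hS := mulComplex_shortExact hJ hJ' hz hJJ' hreg hl
    refine subsingleton_of_forall_eq 0
      fun x : Ext (mulComplex hJ hJ' hz hJJ' hl).X₃ _ i => ?_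
    -- For `i = j` the pullback of `x` is killed by `z`, which acts injectively; for `i ≠ j` the
    -- target of the pullback is zero.
    have hgx : (Ext.mk₀ (mulComplex hJ hJ' hz hJJ' hl).g).comp x (zero_add i) = 0 := by
      by_cases hij : i = j
      · subst hij
        refine T.mul_injective hz hreg hl _ ?_
        exact (Ext.mk₀_comp_mk₀_assoc (mulComplex hJ hJ' hz hJJ' hl).f _ x).trans
          (by rw [ShortComplex.zero, Ext.mk₀_zero, Ext.zero_comp])
      · exact (T.subsingleton l i hij).elim _ _
    cases i with
    | zero =>
      have := hS.epi_g
      exact Ext.precomp_mk₀_injective_of_epi _ (mulComplex hJ hJ' hz hJJ' hl).g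
        (hgx.trans (map_zero _).symm)
    | succ i =>
      obtain ⟨y, rfl⟩ := Ext.contravariant_sequence_exact₃ hS _ x hgx (add_comm 1 i)
      have : y = 0 := (T.subsingleton (l - e) i (by omega)).elim _ _
      subst this
      exact Ext.comp_zero _ _ _ _ _
  toExt {l c} h := T.connect hJ' hz hreg hJJ' (sub_add_cancel l e) (by rw [add_sub, h]; abel)
  surjective {l c} h y := by
    have hS := mulComplex_shortExact hJ hJ' hz hJJ' hreg (sub_add_cancel l e)
    obtain ⟨x, rfl⟩ := Ext.contravariant_sequence_exact₃ hS _ y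
      ((T.subsingleton l (j + 1) (by omega)).elim _ _) (add_comm 1 j)
    obtain ⟨w, rfl⟩ := T.surjective (l := l - e) (c := c) (by rw [add_sub, h]; abel) x
    exact ⟨w, rfl⟩
  eq_zero_iff {l c} h x := by
    have hl : l - e + e = l := sub_add_cancel l e
    have hS := mulComplex_shortExact hJ hJ' hz hJJ' hreg hl
    have h0 : c + (l - e) = k + d := by rw [add_sub, h]; abel
    have h1 : c - e + l = k + d := by rw [← h0]; abel
    have hc : e + (c - e) = c := add_sub_cancel _ _
    change hS.extClass.comp (T.toExt h0 x) (add_comm 1 j) = 0 ↔ _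
    constructor
    · intro hx
      obtain ⟨y, hy⟩ := Ext.contravariant_sequence_exact₁ hS _ _ (add_comm 1 j) hx
      obtain ⟨w, rfl⟩ := T.surjective h1 y
      have hzw : z * (w : A) ∈ 𝒜 c := by
        have := SetLike.GradedMul.mul_mem hz w.2
        rwa [hc] at this
      have hm : _ = T.toExt h0 ⟨_, hzw⟩ := T.mul_comp h1 h0 hz hl w ⟨_, hzw⟩ rfl
      have hd : T.toExt h0 (x - ⟨_, hzw⟩) = 0 := by
        rw [map_sub, sub_eq_zero, ← hm]
        exact hy.symm
      have hd' : (x : A) - z * w ∈ J := (T.eq_zero_iff h0 _).1 hd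
      rw [hJJ', ← sub_add_cancel (x : A) (z * w)]
      exact add_mem (Ideal.mem_sup_left hd')
        (Ideal.mem_sup_right (Ideal.mul_mem_right _ _ (Ideal.mem_span_singleton_self z)))
    · intro hx
      rw [hJJ'] at hx
      obtain ⟨y, hy, hxy⟩ := exists_mem_of_mem_sup_span hJ hz hc x.2 hx
      have hzy : z * y ∈ 𝒜 c := by
        have := SetLike.GradedMul.mul_mem hz hy
        rwa [hc] at this
      have hm : _ = T.toExt h0 ⟨_, hzy⟩ := T.mul_comp h1 h0 hz hl ⟨y, hy⟩ ⟨_, hzy⟩ rfl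
      have hd : T.toExt h0 (x - ⟨_, hzy⟩) = 0 := (T.eq_zero_iff h0 _).2 hxy
      rw [map_sub, sub_eq_zero] at hd
      rw [hd, ← hm]
      exact hS.extClass_comp_assoc _
  mul_comp h h' _ ha hl x y hy := T.mul_comp_connect hJ' hz hreg hJJ' _ _ _ _ ha hl x y hy

end Step

/-! ### Local cohomology from a cofinal family of ideals -/

/-- The local cohomology of `A` with support in `I` vanishes in cohomological degree `i` and
degree `k` if the ideals `J t ⊆ I ^ t` are cofinal to the powers of `I` and
`Ext^i(A / J t, A(k)) = 0`. -/
theorem localCohomology_subsingleton {I : Ideal A} (hI : I.IsHomogeneous 𝒜) {J : ℕ → Ideal A}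
    (hJ : ∀ t, (J t).IsHomogeneous 𝒜) (hJI : ∀ t, J t ≤ I ^ t) (hIJ : ∀ t, ∃ s, I ^ s ≤ J t)
    (i : ℕ) (k : ι)
    (h : ∀ t, Subsingleton (Ext (quotShift (hJ t) 0) ((self 𝒜).shift k) i)) :
    Subsingleton (LocalCohomology hI (self 𝒜) i k) := by
  refine subsingleton_of_forall_eq 0 fun x => ?_
  refine AddCommGroup.DirectLimit.induction_on x fun t x => ?_
  obtain ⟨s, hs⟩ := hIJ t
  -- The transition map from `t` to `max s t` factors through `A / J t`, whose `Ext` vanishes.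
  let α : quotPow hI (max s t) ⟶ quotShift (hJ t) 0 :=
    { lin := Submodule.mapQ (I ^ max s t : Ideal A) (J t) LinearMap.id
        ((Ideal.pow_le_pow_right (le_max_left s t)).trans hs)
      map_deg := by
        rintro i _ ⟨x, hx, rfl⟩
        exact ⟨x, by rwa [add_zero], rfl⟩ }
  let β : quotShift (hJ t) 0 ⟶ quotPow hI t :=
    { lin := Submodule.mapQ (J t) (I ^ t : Ideal A) LinearMap.id (hJI t)
      map_deg := by
        rintro i _ ⟨x, hx, rfl⟩
        exact ⟨x, by rwa [add_zero] at hx, rfl⟩ }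
  have hαβ : quotPowMap hI (le_max_right s t) = α ≫ β := hom_ext fun y => by
    obtain ⟨y, rfl⟩ := Submodule.mkQ_surjective _ y
    rfl
  have h0 : (Ext.mk₀ (quotPowMap hI (le_max_right s t))).precomp ((self 𝒜).shift k)
      (zero_add i) x = 0 := by
    change (Ext.mk₀ (quotPowMap hI (le_max_right s t))).comp x (zero_add i) = 0
    rw [hαβ, ← Ext.mk₀_comp_mk₀_assoc, (h t).elim ((Ext.mk₀ β).comp x (zero_add i)) 0,
      Ext.comp_zero]
  refine (AddCommGroup.DirectLimit.of_f (G := fun t => Ext (quotPow hI t) ((self 𝒜).shift k) i)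
    (f := fun _ _ h => (Ext.mk₀ (quotPowMap hI h)).precomp _ (zero_add i))
    (le_max_right s t) x).symm.trans ?_
  exact (congrArg _ h0).trans (map_zero _)

end GrMod

/-! ### Ideals generated by powers of variables -/

namespace MvPolynomial

section PowIdeal

variable {σ K : Type*} [CommRing K]

/-- The ideal generated by the `t`-th powers of the variables in `S`. -/
noncomputable def powIdeal (K : Type*) [CommRing K] (S : Finset σ) (t : ℕ) :
    Ideal (MvPolynomial σ K) :=
  Ideal.span ((fun s => X s ^ t) '' (S : Set σ))

theorem mem_powIdeal {S : Finset σ} {t : ℕ} {f : MvPolynomial σ K} :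
    f ∈ powIdeal K S t ↔ ∀ v ∈ f.support, ∃ s ∈ S, t ≤ v s := by
  have h : (fun s => X s ^ t : σ → MvPolynomial σ K) '' (S : Set σ) =
      (fun v => monomial v (1 : K)) '' ((fun s => Finsupp.single s t) '' (S : Set σ)) := by
    rw [Set.image_image]
    exact Set.image_congr fun s _ => X_pow_eq_monomial
  rw [powIdeal, h, mem_ideal_span_monomial_image]
  simp

theorem powIdeal_empty (t : ℕ) : powIdeal K (∅ : Finset σ) t = ⊥ := by
  simp [powIdeal]

theorem powIdeal_insert [DecidableEq σ] (s : σ) (S : Finset σ) (t : ℕ) :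
    powIdeal K (insert s S) t = powIdeal K S t ⊔ Ideal.span {X s ^ t} := by
  rw [powIdeal, Finset.coe_insert, Set.image_insert_eq, Ideal.span_insert, sup_comm]
  rfl

/-- The powers of the variables form a regular sequence, in any order. -/
theorem mem_powIdeal_of_X_pow_mul {s : σ} {S : Finset σ} (hs : s ∉ S) {t : ℕ}
    {f : MvPolynomial σ K} (h : X s ^ t * f ∈ powIdeal K S t) : f ∈ powIdeal K S t := by
  classical
  rw [mem_powIdeal] at h ⊢
  intro v hv
  obtain ⟨r, hr, hrv⟩ := h (Finsupp.single s t + v) (by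
    rw [mem_support_iff, X_pow_eq_monomial, coeff_monomial_mul, one_mul]
    exact mem_support_iff.1 hv)
  refine ⟨r, hr, ?_⟩
  rwa [Finsupp.add_apply, Finsupp.single_eq_of_ne (by rintro rfl; exact hs hr), zero_add] at hrv

theorem powIdeal_le (S : Finset σ) (t : ℕ) :
    powIdeal K S t ≤ Ideal.span (X '' (S : Set σ)) ^ t := by
  rw [powIdeal, Ideal.span_le]
  rintro _ ⟨s, hs, rfl⟩
  exact Ideal.pow_mem_pow (Ideal.subset_span (Set.mem_image_of_mem X hs)) t

theorem exists_pow_le_powIdeal (S : Finset σ) (t : ℕ) :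
    ∃ n, Ideal.span (X '' (S : Set σ)) ^ n ≤ powIdeal K S t := by
  refine Ideal.exists_pow_le_of_le_radical_of_fg ?_
    (Submodule.fg_span (S.finite_toSet.image X))
  rw [Ideal.span_le]
  rintro _ ⟨s, hs, rfl⟩
  exact Ideal.mem_radical_iff.2
    ⟨t, Ideal.subset_span (Set.mem_image_of_mem (fun s => X s ^ t) hs)⟩

/-- A polynomial lies in the ideal of `t`-th powers if each of its monomials has total degree
more than `#S * (t - 1)` in the variables of `S`. The inequality is written without subtraction, so
that it has the right meaning for `t = 0`. -/
theorem mem_powIdeal_of_sum {S : Finset σ} {t : ℕ} {f : MvPolynomial σ K}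
    (h : ∀ v ∈ f.support, S.card * t < ∑ s ∈ S, v s + S.card) : f ∈ powIdeal K S t := by
  rw [mem_powIdeal]
  intro v hv
  by_contra! hlt
  have h1 := h v hv
  have h2 : ∑ s ∈ S, (v s + 1) ≤ S.card • t := Finset.sum_le_card_nsmul _ _ _ hlt
  rw [Finset.sum_add_distrib, Finset.sum_const, smul_eq_mul, smul_eq_mul, mul_one] at h2
  omega

end PowIdeal

variable {σ : Type} {K : Type u} [CommRing K] {ι : Type} [DecidableEq ι] [AddCommGroup ι]
  {𝒜 : ι → Submodule K (MvPolynomial σ K)} [GradedAlgebra 𝒜] {w : σ → ι}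

theorem X_pow_mem_of_X_mem (hw : ∀ s, X s ∈ 𝒜 (w s)) (s : σ) (t : ℕ) :
    (X s ^ t : MvPolynomial σ K) ∈ 𝒜 (t • w s) :=
  SetLike.pow_mem_graded t (hw s)

theorem powIdeal_isHomogeneous (hw : ∀ s, X s ∈ 𝒜 (w s)) (S : Finset σ) (t : ℕ) :
    (powIdeal K S t).IsHomogeneous 𝒜 :=
  Ideal.homogeneous_span _ _ (by
    rintro _ ⟨s, -, rfl⟩
    exact ⟨_, X_pow_mem_of_X_mem hw s t⟩)

/-! ### Local cohomology of polynomial rings -/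

open GrMod

/-- Adjoining the powers `X s ^ t` for `s ∈ S` one at a time, each a nonzerodivisor modulo the
previous ones, computes the `Ext` groups of the quotient by the ideal they generate. -/
theorem nonempty_topExt (hw : ∀ s, X s ∈ 𝒜 (w s)) (S : Finset σ) (t : ℕ) (k : ι) :
    Nonempty (TopExt (powIdeal_isHomogeneous hw S t) k (∑ s ∈ S, t • w s) S.card) := by
  classical
  induction S using Finset.induction_on with
  | empty =>
    -- `TopExt` depends on the homogeneity proof, so the ideal is generalized before rewriting.
    have h : ∀ {J : Ideal (MvPolynomial σ K)} (hJ : J.IsHomogeneous 𝒜), J = ⊥ →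
        Nonempty (TopExt hJ k 0 0) := by
      rintro _ _ rfl
      exact ⟨TopExt.bot k⟩
    exact h _ (powIdeal_empty t)
  | insert s S hs ih =>
    obtain ⟨T⟩ := ih
    rw [Finset.sum_insert hs, add_comm (t • w s), Finset.card_insert_of_notMem hs]
    exact ⟨T.step (powIdeal_isHomogeneous hw _ t) (X_pow_mem_of_X_mem hw s t)
      (fun _ => mem_powIdeal_of_X_pow_mul hs) (powIdeal_insert s S t)⟩

/-- The local cohomology of a polynomial ring with support in the ideal generated by the
variables in `S` vanishes except in cohomological degree `#S`, where it vanishes in degree `k` if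
all polynomials of degree `k + ∑ t • w s` lie in the ideal of `t`-th powers. -/
theorem localCohomology_span_X_subsingleton (hw : ∀ s, X s ∈ 𝒜 (w s)) (S : Finset σ)
    {I : Ideal (MvPolynomial σ K)} (hI : I.IsHomogeneous 𝒜)
    (hIS : I = Ideal.span (X '' (S : Set σ))) (i : ℕ) (k : ι)
    (h : i = S.card → ∀ t, ∀ f ∈ 𝒜 (k + ∑ s ∈ S, t • w s), f ∈ powIdeal K S t) :
    Subsingleton (LocalCohomology hI (self 𝒜) i k) := by
  subst hIS
  refine localCohomology_subsingleton hI (powIdeal_isHomogeneous hw S) (powIdeal_le S)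
    (exists_pow_le_powIdeal S) i k fun t => ?_
  obtain ⟨T⟩ := nonempty_topExt hw S t k
  by_cases hi : i = S.card
  · subst hi
    refine subsingleton_of_forall_eq 0 fun x => ?_
    obtain ⟨f, rfl⟩ := T.surjective (add_zero _) x
    exact (T.eq_zero_iff _ f).2 (h rfl t f f.2)
  · exact T.subsingleton 0 i hi

end MvPolynomial

/-! ### Coarsening the grading of a ring -/

namespace GrMod

/-- The two gradings of `A` are equal as families of subgroups, although one is a supremum of
subgroups and the other a supremum of submodules. -/
theorem coarsen_self {K A : Type u} {ι κ : Type} [CommRing K] [CommRing A] [Algebra K A]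
    [DecidableEq ι] [AddCommGroup ι] [DecidableEq κ] [AddCommGroup κ] (𝒜 : ι → Submodule K A)
    [GradedAlgebra 𝒜] (φ : ι →+ κ) :
    (self 𝒜).coarsen φ = self (coarsenRing 𝒜 φ) := by
  have h : (self 𝒜).coarsenDeg φ = fun n => (coarsenRing 𝒜 φ n).toAddSubgroup := by
    funext n
    refine le_antisymm (fun x hx => ?_) (fun x hx => ?_)
    · refine coarsenDeg_le (M := self 𝒜) (φ := φ) (n := n)
        (S := (coarsenRing 𝒜 φ n).toAddSubmonoid) (fun i hi y hy => ?_) hx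
      subst hi
      exact mem_coarsenRing (𝒜 := 𝒜) (a := y) hy
    · refine coarsenRing_le (𝒜 := 𝒜) (φ := φ) (n := n) (a := x)
        (S := ((self 𝒜).coarsenDeg φ n).toAddSubmonoid) (fun i hi y hy => ?_) hx
      subst hi
      exact mem_coarsenDeg (M := self 𝒜) hy
  unfold coarsen self
  congr 1

end GrMod

/-! ### The bigraded polynomial ring -/

namespace Bigraded

open MvPolynomial

variable {K : Type u} [Field K] {m n : ℕ}

theorem degrees_of_mem_bideg {a b : ℤ} {f : Ring K m n} (hf : f ∈ bideg K m n (a, b))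
    {v : Fin (m + 1) ⊕ Fin (n + 1) →₀ ℕ} (hv : v ∈ f.support) :
    (∑ i, v (Sum.inl i) : ℤ) = a ∧ (∑ j, v (Sum.inr j) : ℤ) = b := by
  have h : Finsupp.weight (weight m n) v = (a, b) := hf (mem_support_iff.1 hv)
  rw [Finsupp.weight_apply, Finsupp.sum_fintype _ _ (by simp)] at h
  simpa [weight, Prod.ext_iff, Prod.fst_sum, Prod.snd_sum] using h

end Bigraded

open MvPolynomial Bigraded in
theorem propositionP (K : Type u) [Field K] (m n : ℕ) :
    Bigraded.StronglyRegular 0 0 (GrMod.self (Bigraded.bideg K m n)) := by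
  classical
  intro i
  refine ⟨fun k k' hk => ?_, fun k k' hk => ?_, fun k k' hk => ?_⟩
  · refine localCohomology_span_X_subsingleton (X_mem K m n)
      (Finset.univ.map Function.Embedding.inl) _ ?_ i _ ?_
    · rw [idealX]
      congr 1
      ext; simp
    · rintro rfl t f hf
      refine mem_powIdeal_of_sum fun v hv => ?_
      simp only [Finset.sum_map, Function.Embedding.inl_apply, weight, Sum.elim_inl,
        Finset.sum_const, Finset.card_map, Finset.card_univ, Fintype.card_fin, Prod.smul_mk,
        smul_zero, Prod.mk_add_mk, add_zero] at hf hk ⊢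
      have := (degrees_of_mem_bideg hf hv).1
      simp only [nsmul_eq_mul, mul_one] at this
      zify
      push_cast at *
      linarith
  · refine localCohomology_span_X_subsingleton (X_mem K m n)
      (Finset.univ.map Function.Embedding.inr) _ ?_ i _ ?_
    · rw [idealY]
      congr 1
      ext; simp
    · rintro rfl t f hf
      refine mem_powIdeal_of_sum fun v hv => ?_
      simp only [Finset.sum_map, Function.Embedding.inr_apply, weight, Sum.elim_inr,
        Finset.sum_const, Finset.card_map, Finset.card_univ, Fintype.card_fin, Prod.smul_mk,
        smul_zero, Prod.mk_add_mk, add_zero] at hf hk ⊢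
      have := (degrees_of_mem_bideg hf hv).2
      simp only [nsmul_eq_mul, mul_one] at this
      zify
      push_cast at *
      linarith
  · rw [GrMod.coarsen_self]
    refine localCohomology_span_X_subsingleton
      (fun s => GrMod.mem_coarsenRing (φ := total) (X_mem K m n s)) Finset.univ _ ?_ i _ ?_
    · rw [idealXY, Finset.coe_univ, Set.image_univ]
    · rintro rfl t f hf
      refine GrMod.coarsenRing_le (S := (powIdeal K Finset.univ t).toAddSubmonoid)
        (fun d hd g hg => ?_) hf
      refine mem_powIdeal_of_sum fun v hv => ?_
      have := degrees_of_mem_bideg (a := d.1) (b := d.2) hg hv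
      simp [total, weight] at hd hk ⊢
      zify
      linarith
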